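/- **Definitions.** Let $V=\mathbb R^2$ with the Euclidean norm. Equip $GL(2,\mathbb R)=GL(V)$ with the metric $d(A,B)=\|A-B\|+\|A^{-1}-B^{-1}\|$, where $\|\cdot\|$ is the operator norm; Hölder continuity of $GL(2,\mathbb R)$-valued functions refers to $d$. An Anosov automorphism $f$ of $\mathbb T^2=\mathbb R^2/\mathbb Z^2$ is the automorphism given by a matrix $M\in GL(2,\mathbb Z)$ without eigenvalues of modulus one. Its stable and unstable subspaces are $E^s=\{v: M^nv\to0\}$ and $E^u=\{v:M^{-n}v\to 0\}$, so that $\mathbb R^2=E^s\oplus E^u$, and $W^s(x)=x+E^s$ and $W^u(x)=x+E^u$ (mod $\mathbb Z^2$) are its stable and unstable leaves. *Rates* for $f$ are continuous functions $\nu,\hat\nu:\mathbb T^2\to(0,1)$ such that, for some smooth Riemannian metric on $\mathbb T^2$, $\|Df_x v\|<\nu(x)$ for all $x$ and all unit vectors $v\in E^s$ at $x$, and $\|Df_x v\|>\hat\nu(x)^{-1}$ for all $x$ and all unit vectors $v\in E^u$ at $x$. The cocycle over $f$ generated by $A:\mathbb T^2\to GL(2,\mathbb R)$ is $\mathcal A^n_x=A(f^{n-1}x)\cdots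 A(x)$ and $\mathcal A^{-n}_x=(\mathcal A^n_{f^{-n}x})^{-1}$ for $n\ge0$. It is *smooth* (*constant*) if $A$ is. It is *$\beta$ fiber bunched* (with respect to the rates $\nu,\hat\nu$) if $A$ is $\beta$-Hölder and $\|A(x)\|\,\|A(x)^{-1}\|\,\nu(x)^\beta<1$ and $\|A(x)\|\,\|A(x)^{-1}\|\,\hat\nu(x)^\beta<1$ for all $x$. A *conjugacy* between the cocycles $\mathcal A$ and $\mathcal B$ generated by $A$ and $B$ is any function $C:\mathbb T^2\to GL(2,\mathbb R)$ with $A(x)=C(fx)B(x)C(x)^{-1}$ for all $x$. A *stable holonomy* for $\mathcal A$ is a family $H_{x,y}\in GL(2,\mathbb R)$, $x\in\mathbb T^2$, $y\in W^s(x)$, continuous in $(x,y)$ (leaves carrying their own topology, i.e. $(x,v)\mapsto H_{x,x+v}$ is continuous on $\mathbb T^2\times E^s$), with $H_{x,x}=\mathrm{Id}$, $H_{y,z}H_{x,y}=H_{x,z}$, and $H_{x,y}=(\mathcal A^n_y)^{-1}H_{f^nx,f^ny}\mathcal A^n_x$ for all $n\in\mathbb N$. It is *standard*, and is then denoted $H^{\mathcal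 A,s}$, if $H_{x,y}=\lim_{n\to\infty}(\mathcal A^n_y)^{-1}\mathcal A^n_x$ for all $x$ and $y\in W^s(x)$. Unstable holonomies and the standard one $H^{\mathcal A,u}$ are defined in the same way with $E^u$, $W^u$ and $-n$ in place of $E^s$, $W^s$ and $n$. If $\mathcal A$ and $\mathcal B$ have standard stable and unstable holonomies, a conjugacy $C$ between $\mathcal A$ and $\mathcal B$ *intertwines the standard holonomies* if $H^{\mathcal A,s}_{x,y}=C(y)H^{\mathcal B,s}_{x,y}C(x)^{-1}$ for all $x$ and $y\in W^s(x)$, and $H^{\mathcal A,u}_{x,y}=C(y)H^{\mathcal B,u}_{x,y}C(x)^{-1}$ for all $x$ and $y\in W^u(x)$. **Proposition.** For every $0<\beta'<1$ there exist an Anosov automorphism $f$ of $\mathbb T^2$ with rates $\nu,\hat\nu$, a smooth $GL(2,\mathbb R)$-valued cocycle $\mathcal A$ over $f$, and a constant $GL(2,\mathbb R)$-valued cocycle $\mathcal B$ over $f$ such that: 1. $\mathcal A$ and $\mathcal B$ are both $1$ fiber bunched, with respect to the same rates $\nu,\hat\nu$; 2. there is a $\beta'$-Hölder conjugacy between $\mathcal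 A$ and $\mathcal B$; 3. $\mathcal A$ and $\mathcal B$ have standard stable and unstable holonomies, and no conjugacy between $\mathcal A$ and $\mathcal B$ (of any regularity) intertwines them. -/

import Mathlib

open Filter Topology
open scoped ContDiff Matrix

noncomputable section

namespace HolCocycle

/-! ### Cocycles with values in `GL(V)` over an invertible map -/

section General

variable {X : Type*} {V : Type*} [NormedAddCommGroup V] [NormedSpace ℝ V]

/-- `GL(V)`: the group of invertible continuous linear operators of `V`. Multiplication is
composition, and the topology is the one induced by `glDist`. -/
abbrev GLOp (V : Type*) [NormedAddCommGroup V] [NormedSpace ℝ V] : Type _ := (V →L[ℝ] V)ˣ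

/-- The operator `V → V` underlying an element of `GL(V)`. -/
abbrev GLOp.op (a : GLOp V) : V →L[ℝ] V := Units.val a

/-- The metric `d(a, b) = ‖a - b‖ + ‖a⁻¹ - b⁻¹‖` on `GL(V)`. -/
def glDist (a b : GLOp V) : ℝ := ‖a.op - b.op‖ + ‖(a⁻¹).op - (b⁻¹).op‖

/-- Hölder continuity with exponent `β` of a `GL(V)`-valued function, for the metric `glDist`. -/
def IsHolder [PseudoMetricSpace X] (β : ℝ) (A : X → GLOp V) : Prop :=
  ∃ c : ℝ, ∀ x y : X, glDist (A x) (A y) ≤ c * dist x y ^ β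

/-- `A(fⁿ⁻¹ x) ∘ ⋯ ∘ A(x)` for a natural number `n`. -/
def iterNat (f : Equiv.Perm X) (A : X → GLOp V) : ℕ → X → GLOp V
  | 0, _ => 1
  | n + 1, x => A ((f ^ n) x) * iterNat f A n x

/-- The cocycle over `f` generated by `A`: `𝒜ₓⁿ = A(fⁿ⁻¹ x) ∘ ⋯ ∘ A(x)` and
`𝒜ₓ⁻ⁿ = (𝒜ⁿ at f⁻ⁿ x)⁻¹` for `n ≥ 0`. -/
def iter (f : Equiv.Perm X) (A : X → GLOp V) : ℤ → X → GLOp V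
  | Int.ofNat n, x => iterNat f A n x
  | Int.negSucc n, x => (iterNat f A (n + 1) ((f ^ (n + 1)).symm x))⁻¹

/-- `C` is a conjugacy between the cocycles over `f` generated by `A` and by `B`. No regularity
of `C` is required. -/
def IsConjugacy (f : Equiv.Perm X) (A B C : X → GLOp V) : Prop :=
  ∀ x, A x = C (f x) * B x * (C x)⁻¹

end General

/-! ### Hyperbolic automorphisms of the two-torus -/

/-- The torus `𝕋² = ℝ² / ℤ²`. -/
abbrev Torus : Type := UnitAddTorus (Fin 2)

/-- The universal cover of `𝕋²`, which is also its tangent space at every point. -/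
abbrev Plane : Type := Fin 2 → ℝ

/-- The covering map `ℝ² → 𝕋²`. -/
def proj (v : Plane) : Torus := fun i => (v i : UnitAddCircle)

/-- The endomorphism of `𝕋²` given by an integer matrix. -/
def torusMap (M : Matrix (Fin 2) (Fin 2) ℤ) (x : Torus) : Torus := fun i => ∑ j, M i j • x j

theorem torusMap_mul (M N : Matrix (Fin 2) (Fin 2) ℤ) (x : Torus) :
    torusMap (M * N) x = torusMap M (torusMap N x) := by
  funext i
  simp only [torusMap, Matrix.mul_apply, Fin.sum_univ_two, smul_add, smul_smul, add_smul]
  abel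

theorem torusMap_one (x : Torus) : torusMap 1 x = x := by
  funext i
  simp [torusMap, Matrix.one_apply, ite_smul]

/-- The automorphism of `𝕋²` given by an invertible integer matrix. -/
def torusAut (M : GL (Fin 2) ℤ) : Equiv.Perm Torus where
  toFun := torusMap M.val
  invFun := torusMap (M⁻¹).val
  left_inv x := by rw [← torusMap_mul, Units.inv_mul, torusMap_one]
  right_inv x := by rw [← torusMap_mul, Units.mul_inv, torusMap_one]

/-- The matrix `M` over `ℝ`: the differential of `torusAut M` at every point. -/
def realMat (M : GL (Fin 2) ℤ) : Matrix (Fin 2) (Fin 2) ℝ := M.val.map (Int.cast : ℤ → ℝ)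

/-- The automorphism of `𝕋²` given by `M` is Anosov: `M` has no complex eigenvalue of
modulus one. -/
def IsAnosov (M : GL (Fin 2) ℤ) : Prop :=
  ∀ z : ℂ, (M.val.map (Int.cast : ℤ → ℂ)).charpoly.IsRoot z → ‖z‖ ≠ 1

/-- The stable subspace `Eˢ`: the vectors contracted to zero by the iterates of `M`. -/
def stableSpace (M : GL (Fin 2) ℤ) : Submodule ℝ Plane where
  carrier := {v | Tendsto (fun n : ℕ => (realMat M ^ n) *ᵥ v) atTop (𝓝 0)}
  zero_mem' := by simp
  add_mem' {v w} hv hw := by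
    have h := Tendsto.add hv hw
    simpa only [Set.mem_ofPred_eq, Matrix.mulVec_add, add_zero] using h
  smul_mem' c v hv := by
    have h := Tendsto.const_smul hv c
    simpa only [Set.mem_ofPred_eq, Matrix.mulVec_smul, smul_zero] using h

/-- The unstable subspace `Eᵘ`: the stable subspace of the inverse. -/
def unstableSpace (M : GL (Fin 2) ℤ) : Submodule ℝ Plane := stableSpace M⁻¹

/-- The leaf through `x` of the linear foliation of `𝕋²` tangent to `E`. For `E = Eˢ` it is
`Wˢ(x)`, and for `E = Eᵘ` it is `Wᵘ(x)`. -/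
def leaf (E : Submodule ℝ Plane) (x : Torus) : Set Torus := {y | ∃ v ∈ E, y = x + proj v}

/-- A smooth Riemannian metric on `𝕋²`, given by its Gram matrices in the standard
coordinates. -/
structure RiemMetric where
  gram : Torus → Matrix (Fin 2) (Fin 2) ℝ
  posDef : ∀ x, (gram x).PosDef
  smooth : ∀ i j, ContDiff ℝ ∞ (fun v : Plane => gram (proj v) i j)

/-- The length of the tangent vector `v` at `x`. -/
def RiemMetric.length (g : RiemMetric) (x : Torus) (v : Plane) : ℝ :=
  Real.sqrt (v ⬝ᵥ (g.gram x *ᵥ v))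

/-- The data of (partial) hyperbolicity, with trivial center bundle, of `f = torusAut M`: the
splitting `T𝕋² = Eˢ ⊕ Eᵘ`, a Riemannian metric, and continuous functions `0 < ν, ν' < 1` with
`‖Df v‖ < ν(x)` for unit `v` in `Eˢ` at `x`, and `ν'(x)⁻¹ < ‖Df v‖` for unit `v` in `Eᵘ`
at `x`. -/
structure HyperbolicRates (M : GL (Fin 2) ℤ) where
  splitting : IsCompl (stableSpace M) (unstableSpace M)
  metric : RiemMetric
  nu : Torus → ℝ
  nuHat : Torus → ℝ
  continuous_nu : Continuous nu
  continuous_nuHat : Continuous nuHat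
  nu_pos : ∀ x, 0 < nu x
  nuHat_pos : ∀ x, 0 < nuHat x
  nu_lt_one : ∀ x, nu x < 1
  nuHat_lt_one : ∀ x, nuHat x < 1
  stable : ∀ x, ∀ v ∈ stableSpace M, metric.length x v = 1 →
    metric.length (torusAut M x) (realMat M *ᵥ v) < nu x
  unstable : ∀ x, ∀ v ∈ unstableSpace M, metric.length x v = 1 →
    (nuHat x)⁻¹ < metric.length (torusAut M x) (realMat M *ᵥ v)

section OverTorus

variable {V : Type*} [NormedAddCommGroup V] [NormedSpace ℝ V]

/-- The cocycle generated by `A` is `β` fiber bunched, with respect to the rates `ν, ν'` of the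
base: it is `β`-Hölder, and `‖A(x)‖ ‖A(x)⁻¹‖ ν(x)^β < 1` and `‖A(x)‖ ‖A(x)⁻¹‖ ν'(x)^β < 1`. -/
def IsFiberBunched {M : GL (Fin 2) ℤ} (R : HyperbolicRates M) (β : ℝ) (A : Torus → GLOp V) :
    Prop :=
  IsHolder β A ∧ ∀ x,
    ‖(A x).op‖ * ‖((A x)⁻¹).op‖ * R.nu x ^ β < 1 ∧
    ‖(A x).op‖ * ‖((A x)⁻¹).op‖ * R.nuHat x ^ β < 1

/-- `A : 𝕋² → GL(V)` is smooth: its lift to the universal cover is `C^∞`. -/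
def IsSmooth (A : Torus → GLOp V) : Prop := ContDiff ℝ ∞ (fun v : Plane => (A (proj v)).op)

/-- `H` is continuous in `(x, y)` for `y` in the leaf of `x`, the leaf carrying its own
(immersed) topology. -/
def LeafContinuous (E : Submodule ℝ Plane) (H : Torus → Torus → GLOp V) : Prop :=
  Continuous (fun p : Torus × E => H p.1 (p.1 + proj (p.2 : Plane)))

/-- `H` is a stable holonomy for the cocycle over `torusAut M` generated by `A`; only the values
`H x y` with `y ∈ Wˢ(x)` matter. -/
structure IsStableHolonomy (M : GL (Fin 2) ℤ) (A : Torus → GLOp V)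
    (H : Torus → Torus → GLOp V) : Prop where
  continuous : LeafContinuous (stableSpace M) H
  refl : ∀ x, H x x = 1
  trans : ∀ x, ∀ y ∈ leaf (stableSpace M) x, ∀ z ∈ leaf (stableSpace M) x,
    H y z * H x y = H x z
  invariant : ∀ x, ∀ y ∈ leaf (stableSpace M) x, ∀ n : ℕ,
    H x y = (iter (torusAut M) A n y)⁻¹ *
      H ((torusAut M ^ (n : ℤ)) x) ((torusAut M ^ (n : ℤ)) y) * iter (torusAut M) A n x

/-- `H` is an unstable holonomy for the cocycle over `torusAut M` generated by `A`. -/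
structure IsUnstableHolonomy (M : GL (Fin 2) ℤ) (A : Torus → GLOp V)
    (H : Torus → Torus → GLOp V) : Prop where
  continuous : LeafContinuous (unstableSpace M) H
  refl : ∀ x, H x x = 1
  trans : ∀ x, ∀ y ∈ leaf (unstableSpace M) x, ∀ z ∈ leaf (unstableSpace M) x,
    H y z * H x y = H x z
  invariant : ∀ x, ∀ y ∈ leaf (unstableSpace M) x, ∀ n : ℕ,
    H x y = (iter (torusAut M) A (-(n : ℤ)) y)⁻¹ *
      H ((torusAut M ^ (-(n : ℤ))) x) ((torusAut M ^ (-(n : ℤ))) y) *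
      iter (torusAut M) A (-(n : ℤ)) x

/-- The standard stable holonomy: `H x y = lim (𝒜ⁿ_y)⁻¹ ∘ 𝒜ⁿ_x` in `GL(V)`. -/
def IsStandardStableHolonomy (M : GL (Fin 2) ℤ) (A : Torus → GLOp V)
    (H : Torus → Torus → GLOp V) : Prop :=
  IsStableHolonomy M A H ∧ ∀ x, ∀ y ∈ leaf (stableSpace M) x,
    Tendsto (fun n : ℕ => (iter (torusAut M) A n y)⁻¹ * iter (torusAut M) A n x)
      atTop (𝓝 (H x y))

/-- The standard unstable holonomy: `H x y = lim (𝒜⁻ⁿ_y)⁻¹ ∘ 𝒜⁻ⁿ_x` in `GL(V)`. -/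
def IsStandardUnstableHolonomy (M : GL (Fin 2) ℤ) (A : Torus → GLOp V)
    (H : Torus → Torus → GLOp V) : Prop :=
  IsUnstableHolonomy M A H ∧ ∀ x, ∀ y ∈ leaf (unstableSpace M) x,
    Tendsto (fun n : ℕ => (iter (torusAut M) A (-(n : ℤ)) y)⁻¹ *
      iter (torusAut M) A (-(n : ℤ)) x) atTop (𝓝 (H x y))

/-- `C` intertwines the holonomies `HA` and `HB` along the leaves tangent to `E`:
`HA x y = C(y) ∘ HB x y ∘ C(x)⁻¹` for all `x` and all `y` in the leaf of `x`. -/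
def Intertwines (E : Submodule ℝ Plane) (C : Torus → GLOp V)
    (HA HB : Torus → Torus → GLOp V) : Prop :=
  ∀ x, ∀ y ∈ leaf E x, HA x y = C y * HB x y * (C x)⁻¹

end OverTorus

end HolCocycle

end

noncomputable section

namespace HolCocycle

/-! Write φ for the golden ratio. The base is the Fibonacci automorphism, which expands by φ along
`Eᵘ` and contracts by `φ⁻¹` along `Eˢ`. The cocycles are generated by `A(x) = [[1, w(x)], [0, r]]`
and `b = [[1, 0], [0, r]]` with `φ ^ β' < r < φ`, where `w = ε * wave` is smooth, nonnegative and
zero at the origin.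

A unipotent conjugacy with corner `c` amounts to the equation `r c(fx) = w(x) + c(x)`. It is solved
by the backward series `transfer`, whose terms carry `r⁻ⁿ`. Backward iterates separate points by at
most a constant times `φⁿ`, so `c` is `β'`-Hölder as soon as `φ ^ β' < r`
(`exists_holder_transfer`). Since `r < φ`, a rate `ν` fits between `φ⁻¹` and `r⁻¹`, which makes `b`
fiber bunched with exponent 1, and `A` as well for small `ε`.

The holonomies of `b` are trivial. Hence a map `C` intertwining both kinds of holonomy gives `HAs x
y = C(y) C(x)⁻¹ = HAu x y` whenever `y` lies on both leaves of `x`. The unstable corner is `c(y) -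
c(x)` (`isStandardUnstableHolonomy_shear`); the stable one is the forward series `stableDefect`,
convergent because `r < φ` (`isStandardStableHolonomy_shear`). With `x = 0` and `y` homoclinic to
it, the first is `c(y) ≥ 0`, while the second is minus a sum of nonnegative terms whose initial one,
`w(y)`, is positive. The signs are incompatible. -/

/-! ### Triangular operators of the Euclidean plane -/

/-- The Euclidean plane. -/
abbrev EPlane : Type := EuclideanSpace ℝ (Fin 2)

/-- The operator of the Euclidean plane with matrix `[[1, p], [0, q]]`. -/
def shear (p : ℝ) (q : ℝˣ) : GLOp EPlane where
  val := Matrix.toEuclideanCLM (n := Fin 2) (𝕜 := ℝ) !![1, p; 0, (q : ℝ)]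
  inv := Matrix.toEuclideanCLM (n := Fin 2) (𝕜 := ℝ)
    !![1, -p * ((q⁻¹ : ℝˣ) : ℝ); 0, ((q⁻¹ : ℝˣ) : ℝ)]
  val_inv := by
    rw [← map_mul, ← map_one (Matrix.toEuclideanCLM (n := Fin 2) (𝕜 := ℝ))]
    congr 1
    ext i j
    fin_cases i <;> fin_cases j <;> simp [Matrix.mul_apply]
  inv_val := by
    rw [← map_mul, ← map_one (Matrix.toEuclideanCLM (n := Fin 2) (𝕜 := ℝ))]
    congr 1
    ext i j
    fin_cases i <;> fin_cases j <;> simp [Matrix.mul_apply]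

theorem shear_op (p : ℝ) (q : ℝˣ) :
    (shear p q).op = Matrix.toEuclideanCLM (n := Fin 2) (𝕜 := ℝ) !![1, p; 0, (q : ℝ)] := rfl

theorem shear_mul (p p' : ℝ) (q q' : ℝˣ) :
    shear p q * shear p' q' = shear (p' + p * q') (q * q') := by
  apply Units.ext
  change Matrix.toEuclideanCLM (n := Fin 2) (𝕜 := ℝ) _ *
    Matrix.toEuclideanCLM (n := Fin 2) (𝕜 := ℝ) _ = Matrix.toEuclideanCLM (n := Fin 2) (𝕜 := ℝ) _
  rw [← map_mul]
  congr 1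
  ext i j
  fin_cases i <;> fin_cases j <;> simp [Matrix.mul_apply]

theorem shear_zero_one : shear 0 1 = 1 := by
  apply Units.ext
  change Matrix.toEuclideanCLM (n := Fin 2) (𝕜 := ℝ) _ = 1
  rw [← map_one (Matrix.toEuclideanCLM (n := Fin 2) (𝕜 := ℝ))]
  congr 1
  ext i j
  fin_cases i <;> fin_cases j <;> simp

theorem shear_inv (p : ℝ) (q : ℝˣ) :
    (shear p q)⁻¹ = shear (-p * ((q⁻¹ : ℝˣ) : ℝ)) q⁻¹ := by
  rw [inv_eq_iff_mul_eq_one, shear_mul, ← shear_zero_one]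
  congr 1 <;> simp

theorem shear_zero_pow (q : ℝˣ) (n : ℕ) : shear 0 q ^ n = shear 0 (q ^ n) := by
  induction n with
  | zero => simp [shear_zero_one]
  | succ n ih => rw [pow_succ, ih, shear_mul, pow_succ]; simp

theorem shear_injective (q : ℝˣ) : Function.Injective (fun p => shear p q) := by
  intro p p' h
  have h1 := congrArg Units.val h
  have h2 := (Matrix.toEuclideanCLM (n := Fin 2) (𝕜 := ℝ)).injective h1
  simpa using congrFun (congrFun h2 0) 1

/-- The diagonal part has norm at most `k`, the nilpotent part at most `|p|`. The entry `a` is free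
so that differences of shears, with `a = q = 0`, are covered too. -/
theorem norm_triangular_le (a p q k : ℝ) (ha : |a| ≤ k) (hq : |q| ≤ k) :
    ‖Matrix.toEuclideanCLM (n := Fin 2) (𝕜 := ℝ) !![a, p; 0, q]‖ ≤ k + |p| := by
  have hk : 0 ≤ k := (abs_nonneg a).trans ha
  have split : (!![a, p; 0, q] : Matrix (Fin 2) (Fin 2) ℝ) = !![a, 0; 0, q] + !![0, p; 0, 0] := by
    ext i j
    fin_cases i <;> fin_cases j <;> simp
  rw [split, map_add]
  refine (norm_add_le _ _).trans (add_le_add ?_ ?_)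
  · refine ContinuousLinearMap.opNorm_le_bound _ hk fun v => ?_
    rw [EuclideanSpace.norm_eq, EuclideanSpace.norm_eq, ← Real.sqrt_sq hk,
      ← Real.sqrt_mul (sq_nonneg k)]
    apply Real.sqrt_le_sqrt
    have h1 : a ^ 2 ≤ k ^ 2 := sq_le_sq' (abs_le.1 ha).1 (abs_le.1 ha).2
    have h2 : q ^ 2 ≤ k ^ 2 := sq_le_sq' (abs_le.1 hq).1 (abs_le.1 hq).2
    simp [Matrix.mulVec, dotProduct, Fin.sum_univ_two, mul_pow, Matrix.ofLp_toEuclideanCLM]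
    nlinarith [mul_le_mul_of_nonneg_right h1 (sq_nonneg (v 0)),
      mul_le_mul_of_nonneg_right h2 (sq_nonneg (v 1))]
  · refine ContinuousLinearMap.opNorm_le_bound _ (abs_nonneg p) fun v => ?_
    rw [EuclideanSpace.norm_eq, EuclideanSpace.norm_eq, ← Real.sqrt_sq (abs_nonneg p),
      ← Real.sqrt_mul (sq_nonneg |p|)]
    apply Real.sqrt_le_sqrt
    simp [Matrix.mulVec, dotProduct, Fin.sum_univ_two, mul_pow, Matrix.ofLp_toEuclideanCLM]
    nlinarith [mul_nonneg (sq_nonneg p) (sq_nonneg (v 0))]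

theorem norm_shear_le (p : ℝ) (q : ℝˣ) (k : ℝ) (h1 : 1 ≤ k) (hq : |(q : ℝ)| ≤ k) :
    ‖(shear p q).op‖ ≤ k + |p| :=
  norm_triangular_le _ _ _ _ (by simpa using h1) hq

theorem glDist_shear_le (p p' : ℝ) (q : ℝˣ) :
    glDist (shear p q) (shear p' q) ≤ |p - p'| * (1 + |((q⁻¹ : ℝˣ) : ℝ)|) := by
  have key : ∀ (s s' : ℝ) (u : ℝˣ), ‖(shear s u).op - (shear s' u).op‖ ≤ |s - s'| := by
    intro s s' u
    rw [shear_op, shear_op, ← map_sub]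
    have e : (!![1, s; 0, (u : ℝ)] : Matrix (Fin 2) (Fin 2) ℝ) - !![1, s'; 0, (u : ℝ)] =
        !![0, s - s'; 0, 0] := by
      ext i j
      fin_cases i <;> fin_cases j <;> simp
    rw [e]
    simpa using norm_triangular_le 0 (s - s') 0 0 (by simp) (by simp)
  rw [glDist, shear_inv, shear_inv, mul_add, mul_one]
  refine add_le_add (key _ _ _) ((key _ _ _).trans (le_of_eq ?_))
  rw [← abs_mul, ← abs_neg]
  congr 1
  ring

theorem continuous_shear_one : Continuous fun p => shear p 1 := by
  have h : Continuous fun p : ℝ =>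
      Matrix.toEuclideanCLM (n := Fin 2) (𝕜 := ℝ) !![1, p; 0, 1] := by
    refine (LinearMap.continuous_of_finiteDimensional
      (Matrix.toEuclideanCLM (n := Fin 2) (𝕜 := ℝ)).toAlgEquiv.toLinearMap).comp ?_
    refine continuous_matrix fun i j => ?_
    fin_cases i <;> fin_cases j <;> simp <;> fun_prop
  -- The topology of the unit group also requires continuity of the inverse, here `p ↦ shear (-p)
  -- 1`.
  rw [Units.continuous_iff]
  refine ⟨by simpa [Function.comp_def, shear] using h, ?_⟩
  simpa [Function.comp_def, shear_inv, shear] using h.comp continuous_neg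

theorem contDiff_shear_op {E : Type*} [NormedAddCommGroup E] [NormedSpace ℝ E] {w : E → ℝ}
    (hw : ContDiff ℝ ∞ w) (q : ℝˣ) : ContDiff ℝ ∞ fun v => (shear (w v) q).op := by
  have e : (fun v => (shear (w v) q).op) = fun v =>
      (shear 0 q).op + w v • Matrix.toEuclideanCLM (n := Fin 2) (𝕜 := ℝ) !![0, 1; 0, 0] := by
    funext v
    rw [shear_op, shear_op, ← map_smul, ← map_add]
    congr 1
    ext i j
    fin_cases i <;> fin_cases j <;> simp
  rw [e]
  exact contDiff_const.add (hw.smul contDiff_const)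

/-! ### Cocycles: conjugacies and constant generators -/

section Cocycle

variable {X V : Type*} [NormedAddCommGroup V] [NormedSpace ℝ V]

theorem iter_natCast (f : Equiv.Perm X) (A : X → GLOp V) (n : ℕ) (x : X) :
    iter f A (n : ℤ) x = iterNat f A n x := rfl

theorem iter_neg_natCast (f : Equiv.Perm X) (A : X → GLOp V) (n : ℕ) (x : X) :
    iter f A (-(n : ℤ)) x = (iterNat f A n ((f⁻¹ ^ n) x))⁻¹ := by
  cases n with
  | zero => simp [iterNat, iter]
  | succ n =>
    rw [inv_pow]
    rfl

theorem iterNat_const (f : Equiv.Perm X) (b : GLOp V) (n : ℕ) (x : X) :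
    iterNat f (fun _ => b) n x = b ^ n := by
  induction n with
  | zero => rfl
  | succ n ih => rw [iterNat, ih, pow_succ']

theorem IsConjugacy.iterNat {f : Equiv.Perm X} {A B C : X → GLOp V} (h : IsConjugacy f A B C)
    (n : ℕ) (x : X) : iterNat f A n x = C ((f ^ n) x) * HolCocycle.iterNat f B n x * (C x)⁻¹ := by
  induction n with
  | zero => simp [HolCocycle.iterNat]
  | succ n ih =>
    rw [HolCocycle.iterNat, ih, h, HolCocycle.iterNat, pow_succ', Equiv.Perm.mul_apply]
    group

/-- Along negative times a cocycle conjugate to a constant one is a coboundary twisted by powers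
of the constant. -/
theorem IsConjugacy.iter_neg {f : Equiv.Perm X} {A C : X → GLOp V} {b : GLOp V}
    (h : IsConjugacy f A (fun _ => b) C) (n : ℕ) (x : X) :
    iter f A (-(n : ℤ)) x = C ((f⁻¹ ^ n) x) * (b ^ n)⁻¹ * (C x)⁻¹ := by
  rw [iter_neg_natCast, h.iterNat, iterNat_const, ← Equiv.Perm.mul_apply, inv_pow,
    mul_inv_cancel]
  simp only [Equiv.Perm.one_apply]
  group

end Cocycle

/-! ### Triangular cocycles and the cohomological equation -/

section ShearCocycle

variable {X : Type*} (f : Equiv.Perm X) (w : X → ℝ) (r : ℝˣ)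

theorem iterNat_shear (n : ℕ) (x : X) :
    iterNat f (fun x => shear (w x) r) n x =
      shear (∑ k ∈ Finset.range n, (r : ℝ) ^ k * w ((f ^ k) x)) (r ^ n) := by
  induction n with
  | zero => simp [iterNat, shear_zero_one]
  | succ n ih =>
    rw [iterNat, ih, shear_mul, Finset.sum_range_succ, ← pow_succ']
    congr 2
    push_cast
    ring

theorem iterNat_shear_inv_mul (n : ℕ) (x y : X) :
    (iterNat f (fun x => shear (w x) r) n y)⁻¹ * iterNat f (fun x => shear (w x) r) n x =
      shear (∑ k ∈ Finset.range n, (r : ℝ) ^ k * (w ((f ^ k) x) - w ((f ^ k) y))) 1 := by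
  rw [iterNat_shear, iterNat_shear, shear_inv, shear_mul]
  simp only [mul_sub, Finset.sum_sub_distrib, inv_mul_cancel]
  congr 1
  simp
  ring

/-- The bounded solution of the cohomological equation `w = r • c ∘ f - c`. -/
def transfer (x : X) : ℝ := ∑' n : ℕ, ((r : ℝ)⁻¹) ^ (n + 1) * w ((f⁻¹ ^ (n + 1)) x)

end ShearCocycle

section Transfer

variable {X : Type*} {f : Equiv.Perm X} {w : X → ℝ} {r : ℝˣ} {K : ℝ}

theorem abs_transfer_term_le (hr : 1 < (r : ℝ)) (hw : ∀ x, |w x| ≤ K) (n : ℕ) (x : X) :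
    |((r : ℝ)⁻¹) ^ (n + 1) * w ((f⁻¹ ^ (n + 1)) x)| ≤ K * ((r : ℝ)⁻¹) ^ (n + 1) := by
  have h0 : 0 ≤ ((r : ℝ)⁻¹) ^ (n + 1) := by positivity
  rw [abs_mul, abs_of_nonneg h0, mul_comm]
  exact mul_le_mul_of_nonneg_right (hw _) h0

theorem summable_const_mul_inv_pow_succ (hr : 1 < (r : ℝ)) (K : ℝ) :
    Summable fun n : ℕ => K * ((r : ℝ)⁻¹) ^ (n + 1) :=
  ((summable_nat_add_iff 1).2
    (summable_geometric_of_lt_one (by positivity) (inv_lt_one_of_one_lt₀ hr))).mul_left K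

theorem summable_transfer (hr : 1 < (r : ℝ)) (hw : ∀ x, |w x| ≤ K) (x : X) :
    Summable fun n : ℕ => ((r : ℝ)⁻¹) ^ (n + 1) * w ((f⁻¹ ^ (n + 1)) x) :=
  Summable.of_norm_bounded (summable_const_mul_inv_pow_succ hr K)
    fun n => abs_transfer_term_le hr hw n x

theorem abs_transfer_le (hr : 1 < (r : ℝ)) (hw : ∀ x, |w x| ≤ K) (x : X) :
    |transfer f w r x| ≤ ∑' n : ℕ, K * ((r : ℝ)⁻¹) ^ (n + 1) :=
  tsum_of_norm_bounded (f := fun n : ℕ => ((r : ℝ)⁻¹) ^ (n + 1) * w ((f⁻¹ ^ (n + 1)) x))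
    (summable_const_mul_inv_pow_succ hr K).hasSum fun n => abs_transfer_term_le hr hw n x

/-- Passing from `x` to `f x` and multiplying by `r` shifts the series by one index; the new initial
term is `w x`. -/
theorem transfer_cohomological (hr : 1 < (r : ℝ)) (hw : ∀ x, |w x| ≤ K) (x : X) :
    transfer f w r (f x) * r = w x + transfer f w r x := by
  have hr0 : (r : ℝ) ≠ 0 := r.ne_zero
  have key : ∀ n : ℕ, ((r : ℝ)⁻¹) ^ (n + 1) * w ((f⁻¹ ^ (n + 1)) (f x)) * r =
      ((r : ℝ)⁻¹) ^ n * w ((f⁻¹ ^ n) x) := by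
    intro n
    have e : (f⁻¹ ^ (n + 1)) (f x) = (f⁻¹ ^ n) x := by
      rw [pow_succ, Equiv.Perm.mul_apply, ← Equiv.Perm.mul_apply f⁻¹, inv_mul_cancel,
        Equiv.Perm.one_apply]
    rw [e, pow_succ]
    field_simp
  have hs : Summable fun n : ℕ => ((r : ℝ)⁻¹) ^ n * w ((f⁻¹ ^ n) x) :=
    (summable_nat_add_iff 1).1 (summable_transfer hr hw x)
  rw [transfer, ← tsum_mul_right]
  simp only [key]
  rw [hs.tsum_eq_zero_add]
  simp [transfer]

theorem isConjugacy_shear_transfer (hr : 1 < (r : ℝ)) (hw : ∀ x, |w x| ≤ K) :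
    IsConjugacy f (fun x => shear (w x) r) (fun _ => shear 0 r)
      (fun x => shear (transfer f w r x) 1) := by
  intro x
  rw [shear_inv, shear_mul, shear_mul, zero_add, transfer_cohomological hr hw]
  simp

/-- With `C` the transfer conjugacy and `b` the constant, the product is `C(y) bⁿ C(f⁻ⁿy)⁻¹ C(f⁻ⁿx)
b⁻ⁿ C(x)⁻¹`. Conjugation by `bⁿ` multiplies the corner of the middle unipotent factor by `r⁻ⁿ`, and
`transfer` is bounded, so the limit is `C(y) C(x)⁻¹`. -/
theorem tendsto_iter_neg_shear (hr : 1 < (r : ℝ)) (hw : ∀ x, |w x| ≤ K) (x y : X) :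
    Tendsto (fun n : ℕ => (iter f (fun x => shear (w x) r) (-(n : ℤ)) y)⁻¹ *
      iter f (fun x => shear (w x) r) (-(n : ℤ)) x) atTop
      (𝓝 (shear (transfer f w r y - transfer f w r x) 1)) := by
  have e : ∀ n : ℕ, (iter f (fun x => shear (w x) r) (-(n : ℤ)) y)⁻¹ *
      iter f (fun x => shear (w x) r) (-(n : ℤ)) x =
      shear (transfer f w r y - transfer f w r x + ((r : ℝ)⁻¹) ^ n *
        (transfer f w r ((f⁻¹ ^ n) x) - transfer f w r ((f⁻¹ ^ n) y))) 1 := by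
    intro n
    rw [(isConjugacy_shear_transfer hr hw).iter_neg, (isConjugacy_shear_transfer hr hw).iter_neg]
    simp only [shear_zero_pow, shear_inv, shear_mul]
    congr 1
    · simp
      ring
    · simp
  simp only [e]
  refine (continuous_shear_one.tendsto _).comp ?_
  have h0 : Tendsto (fun n : ℕ => ((r : ℝ)⁻¹) ^ n *
        (transfer f w r ((f⁻¹ ^ n) x) - transfer f w r ((f⁻¹ ^ n) y))) atTop (𝓝 0) := by
    set D := ∑' n : ℕ, K * ((r : ℝ)⁻¹) ^ (n + 1) with hD
    refine squeeze_zero_norm (a := fun n : ℕ => ((r : ℝ)⁻¹) ^ n * (D + D)) (fun n => ?_) ?_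
    · rw [norm_mul, Real.norm_of_nonneg (by positivity : 0 ≤ ((r : ℝ)⁻¹) ^ n)]
      refine mul_le_mul_of_nonneg_left ((norm_sub_le _ _).trans ?_) (by positivity)
      exact add_le_add (abs_transfer_le hr hw _) (abs_transfer_le hr hw _)
    · simpa using (tendsto_pow_atTop_nhds_zero_of_lt_one (by positivity)
        (inv_lt_one_of_one_lt₀ hr)).mul_const (D + D)
  simpa using h0.const_add (transfer f w r y - transfer f w r x)

end Transfer

/-! ### Torus automorphisms and their lifts -/

theorem continuous_proj : Continuous proj :=
  continuous_pi fun i => (AddCircle.continuous_mk' (1 : ℝ)).comp (continuous_apply i)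

theorem proj_add (v u : Plane) : proj (v + u) = proj v + proj u := rfl

theorem proj_zero : proj 0 = 0 := rfl

theorem continuous_torusAut (M : GL (Fin 2) ℤ) : Continuous (torusAut M) := by
  refine continuous_pi fun i => ?_
  change Continuous fun x : Torus => ∑ j, M.val i j • x j
  fun_prop

theorem continuous_torusAut_pow (M : GL (Fin 2) ℤ) (n : ℕ) : Continuous (torusAut M ^ n) := by
  induction n with
  | zero => exact continuous_id
  | succ n ih => rw [pow_succ]; exact ih.comp (continuous_torusAut M)

theorem torusAut_inv (M : GL (Fin 2) ℤ) : (torusAut M)⁻¹ = torusAut M⁻¹ := rfl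

theorem torusAut_add (M : GL (Fin 2) ℤ) (x y : Torus) :
    torusAut M (x + y) = torusAut M x + torusAut M y := by
  funext i
  change ∑ j, M.val i j • (x j + y j) = ∑ j, M.val i j • x j + ∑ j, M.val i j • y j
  simp [smul_add, Finset.sum_add_distrib]

theorem torusAut_proj (M : GL (Fin 2) ℤ) (v : Plane) :
    torusAut M (proj v) = proj (realMat M *ᵥ v) := by
  funext i
  change ∑ j, M.val i j • ((v j : ℝ) : UnitAddCircle) = ((realMat M *ᵥ v) i : UnitAddCircle)
  simp [realMat, Matrix.mulVec, dotProduct, Fin.sum_univ_two, ← zsmul_eq_mul]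

theorem torusAut_pow_add_proj (M : GL (Fin 2) ℤ) (n : ℕ) (x : Torus) (v : Plane) :
    (torusAut M ^ n) (x + proj v) = (torusAut M ^ n) x + proj ((realMat M ^ n) *ᵥ v) := by
  induction n with
  | zero => simp
  | succ n ih =>
    rw [pow_succ', Equiv.Perm.mul_apply, ih, torusAut_add, torusAut_proj, pow_succ',
      Equiv.Perm.mul_apply, Matrix.mulVec_mulVec]

theorem torusAut_pow_zero (M : GL (Fin 2) ℤ) (n : ℕ) : (torusAut M ^ n) 0 = 0 := by
  induction n with
  | zero => rfl
  | succ n ih =>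
    rw [pow_succ', Equiv.Perm.mul_apply, ih, ← proj_zero, torusAut_proj, Matrix.mulVec_zero]

/-- Any two points of the torus differ by a vector of length their distance. -/
theorem exists_eq_add_proj (x y : Torus) : ∃ v : Plane, y = x + proj v ∧ ‖v‖ = dist x y := by
  have h : ∀ t : UnitAddCircle, ∃ s : ℝ, (s : UnitAddCircle) = t ∧ |s| = ‖t‖ := by
    intro t
    induction t using QuotientAddGroup.induction_on with
    | H s =>
      -- The representative nearest to zero realizes the quotient norm.
      refine ⟨s - round s, ?_, ?_⟩
      · rw [AddCircle.coe_sub]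
        have : ((round s : ℝ) : UnitAddCircle) = 0 := by
          rw [AddCircle.coe_eq_zero_iff]
          exact ⟨round s, by simp⟩
        rw [this, sub_zero]
      · exact (UnitAddCircle.norm_eq (x := s)).symm
  choose s hs hn using fun i => h (y i - x i)
  refine ⟨s, ?_, ?_⟩
  · funext i
    change y i = x i + (s i : UnitAddCircle)
    rw [hs]
    abel
  · rw [dist_comm, dist_eq_norm, Pi.norm_def, Pi.norm_def]
    congr 2
    funext i
    apply NNReal.eq
    simpa using hn i

theorem continuous_add_proj (E : Submodule ℝ Plane) :
    Continuous fun p : Torus × E => p.1 + proj (p.2 : Plane) :=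
  continuous_fst.add (continuous_proj.comp (continuous_subtype_val.comp continuous_snd))

/-! ### Standard holonomies -/

section Constant

variable {V : Type*} [NormedAddCommGroup V] [NormedSpace ℝ V]

theorem iter_const (f : Equiv.Perm Torus) (b : GLOp V) (n : ℤ) (x y : Torus) :
    iter f (fun _ => b) n x = iter f (fun _ => b) n y := by
  cases n with
  | ofNat n => simp [iter, iterNat_const]
  | negSucc n => simp [iter, iterNat_const]

theorem isStandardStableHolonomy_const (M : GL (Fin 2) ℤ) (b : GLOp V) :
    IsStandardStableHolonomy M (fun _ => b) (fun _ _ => 1) := by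
  refine ⟨⟨continuous_const, fun _ => rfl, fun _ _ _ _ _ => one_mul 1, fun x y _ n => ?_⟩,
    fun x y _ => ?_⟩
  · rw [iter_const _ b n y x]
    group
  · simp only [iter_const _ b _ y x, inv_mul_cancel]
    exact tendsto_const_nhds

theorem isStandardUnstableHolonomy_const (M : GL (Fin 2) ℤ) (b : GLOp V) :
    IsStandardUnstableHolonomy M (fun _ => b) (fun _ _ => 1) := by
  refine ⟨⟨continuous_const, fun _ => rfl, fun _ _ _ _ _ => one_mul 1, fun x y _ n => ?_⟩,
    fun x y _ => ?_⟩
  · rw [iter_const _ b _ y x]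
    group
  · simp only [iter_const _ b _ y x, inv_mul_cancel]
    exact tendsto_const_nhds

end Constant

theorem continuous_transfer {M : GL (Fin 2) ℤ} {w : Torus → ℝ} {r : ℝˣ} {K : ℝ}
    (hc : Continuous w) (hr : 1 < (r : ℝ)) (hw : ∀ x, |w x| ≤ K) :
    Continuous (transfer (torusAut M) w r) := by
  refine continuous_tsum (fun n => ?_) (summable_const_mul_inv_pow_succ hr K)
    fun n x => abs_transfer_term_le hr hw n x
  rw [torusAut_inv]
  exact continuous_const.mul (hc.comp (continuous_torusAut_pow _ _))

/-- The holonomy is the coboundary `C(y) C(x)⁻¹` of the transfer conjugacy: composition telescopes,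
and invariance is the conjugacy relation together with the fact that the iterates of the constant do
not depend on the base point. -/
theorem isStandardUnstableHolonomy_shear {M : GL (Fin 2) ℤ} {w : Torus → ℝ} {r : ℝˣ} {K : ℝ}
    (hc : Continuous w) (hr : 1 < (r : ℝ)) (hw : ∀ x, |w x| ≤ K) :
    IsStandardUnstableHolonomy M (fun x => shear (w x) r) (fun x y =>
      shear (transfer (torusAut M) w r y - transfer (torusAut M) w r x) 1) := by
  refine ⟨⟨?_, fun x => ?_, fun x y _ z _ => ?_, fun x y _ n => ?_⟩,
    fun x y _ => tendsto_iter_neg_shear hr hw x y⟩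
  · refine continuous_shear_one.comp (Continuous.sub ?_ ?_)
    · exact (continuous_transfer hc hr hw).comp (continuous_add_proj _)
    · exact (continuous_transfer hc hr hw).comp continuous_fst
  · rw [sub_self, shear_zero_one]
  · rw [shear_mul]
    congr 1 <;> simp
  · have e : torusAut M ^ (-(n : ℤ)) = (torusAut M)⁻¹ ^ n := by
      rw [zpow_neg, zpow_natCast, inv_pow]
    rw [(isConjugacy_shear_transfer hr hw).iter_neg, (isConjugacy_shear_transfer hr hw).iter_neg,
      e]
    simp only [shear_zero_pow, shear_inv, shear_mul]
    have hr0 : (r : ℝ) ≠ 0 := r.ne_zero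
    congr 1
    · simp
      field_simp
      ring
    · simp

/-- The off-diagonal entry of the standard stable holonomy of `x ↦ shear (w x) r`. -/
def stableDefect {X : Type*} (f : Equiv.Perm X) (w : X → ℝ) (r : ℝˣ) (x y : X) : ℝ :=
  ∑' k : ℕ, (r : ℝ) ^ k * (w ((f ^ k) x) - w ((f ^ k) y))

section Stable

variable {M : GL (Fin 2) ℤ} {w : Torus → ℝ} {r : ℝˣ} {K θ : ℝ}

theorem summable_stableDefect (hθ0 : 0 ≤ θ) (hθ1 : θ < 1)
    (hdecay : ∀ x, ∀ v ∈ stableSpace M, ∀ k : ℕ,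
      |(r : ℝ) ^ k * (w ((torusAut M ^ k) x) - w ((torusAut M ^ k) (x + proj v)))| ≤
        K * ‖v‖ * θ ^ k) (x y : Torus) (hy : y ∈ leaf (stableSpace M) x) :
    Summable fun k : ℕ => (r : ℝ) ^ k * (w ((torusAut M ^ k) x) - w ((torusAut M ^ k) y)) := by
  obtain ⟨v, hv, rfl⟩ := hy
  exact Summable.of_norm_bounded
    ((summable_geometric_of_lt_one hθ0 hθ1).mul_left (K * ‖v‖)) fun k => hdecay x v hv k

theorem leaf_trans {E : Submodule ℝ Plane} {x y z : Torus} (hy : y ∈ leaf E x)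
    (hz : z ∈ leaf E x) : z ∈ leaf E y := by
  obtain ⟨v, hv, rfl⟩ := hy
  obtain ⟨u, hu, rfl⟩ := hz
  refine ⟨u - v, E.sub_mem hu hv, ?_⟩
  rw [add_assoc, ← proj_add, add_sub_cancel]

/-- By `hdecay` the contraction of stable leaves beats the growth `r ^ k`, so the defect series
converges geometrically. Its partial sums are the corners of `(𝒜ⁿ_y)⁻¹ 𝒜ⁿ_x`. -/
theorem isStandardStableHolonomy_shear (hc : Continuous w) (hK : 0 ≤ K) (hθ0 : 0 ≤ θ)
    (hθ1 : θ < 1)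
    (hdecay : ∀ x, ∀ v ∈ stableSpace M, ∀ k : ℕ,
      |(r : ℝ) ^ k * (w ((torusAut M ^ k) x) - w ((torusAut M ^ k) (x + proj v)))| ≤
        K * ‖v‖ * θ ^ k) :
    IsStandardStableHolonomy M (fun x => shear (w x) r)
      (fun x y => shear (stableDefect (torusAut M) w r x y) 1) := by
  refine ⟨⟨?_, fun x => ?_, fun x y hy z hz => ?_, fun x y hy n => ?_⟩, fun x y hy => ?_⟩
  · refine continuous_shear_one.comp (continuous_iff_continuousAt.2 fun p => ?_)
    -- The decay bound is proportional to `‖v‖`, so convergence is uniform only over bounded sets of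
    -- leaf vectors.
    have hopen : {q : Torus × stableSpace M | ‖(q.2 : Plane)‖ < ‖(p.2 : Plane)‖ + 1} ∈ 𝓝 p :=
      (isOpen_lt (continuous_subtype_val.comp continuous_snd).norm continuous_const).mem_nhds
        (lt_add_one ‖(p.2 : Plane)‖)
    refine ContinuousOn.continuousAt ?_ hopen
    refine continuousOn_tsum (u := fun k => K * (‖(p.2 : Plane)‖ + 1) * θ ^ k) (fun k => ?_)
      ((summable_geometric_of_lt_one hθ0 hθ1).mul_left _) fun k q hq => ?_
    · refine Continuous.continuousOn (continuous_const.mul (Continuous.sub ?_ ?_))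
      · exact hc.comp ((continuous_torusAut_pow M k).comp continuous_fst)
      · exact hc.comp ((continuous_torusAut_pow M k).comp (continuous_add_proj _))
    · refine (hdecay q.1 q.2 q.2.2 k).trans ?_
      exact mul_le_mul_of_nonneg_right (mul_le_mul_of_nonneg_left (le_of_lt hq) hK) (by positivity)
  · simp [stableDefect, shear_zero_one]
  · rw [shear_mul]
    congr 1
    · rw [Units.val_one, mul_one, stableDefect, stableDefect, stableDefect,
        ← (summable_stableDefect hθ0 hθ1 hdecay x y hy).tsum_add
          (summable_stableDefect hθ0 hθ1 hdecay y z (leaf_trans hy hz))]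
      congr 1
      funext k
      ring
    · simp
  · rw [iter_natCast, iter_natCast, mul_assoc, iterNat_shear, iterNat_shear, shear_inv,
      shear_mul, shear_mul]
    congr 1
    -- The first `n` terms come from the two iterates; the tail is `r ^ n` times the defect at time
    -- `n`.
    · rw [stableDefect, ← (summable_stableDefect hθ0 hθ1 hdecay x y hy).sum_add_tsum_nat_add n]
      have e : stableDefect (torusAut M) w r ((torusAut M ^ (n : ℤ)) x)
          ((torusAut M ^ (n : ℤ)) y) * (r : ℝ) ^ n =
          ∑' k : ℕ, (r : ℝ) ^ (k + n) *
            (w ((torusAut M ^ (k + n)) x) - w ((torusAut M ^ (k + n)) y)) := by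
        rw [stableDefect, ← tsum_mul_right]
        congr 1
        funext k
        simp only [zpow_natCast, ← Equiv.Perm.mul_apply, ← pow_add]
        ring
      rw [← e]
      simp [mul_sub, Finset.sum_sub_distrib]
      ring
    · simp
  · simp only [iter_natCast, iterNat_shear_inv_mul]
    exact (continuous_shear_one.tendsto _).comp
      (summable_stableDefect hθ0 hθ1 hdecay x y hy).hasSum.tendsto_sum_nat

end Stable

/-! ### The Fibonacci automorphism -/

/-- The matrix `[[1, 1], [1, 0]]`. -/
def fibMat : GL (Fin 2) ℤ := ⟨!![1, 1; 1, 0], !![0, 1; 1, -1], by decide, by decide⟩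

theorem realMat_fibMat : realMat fibMat = !![1, 1; 1, 0] := by
  ext i j
  fin_cases i <;> fin_cases j <;> simp [realMat, fibMat]

theorem realMat_fibMat_inv : realMat fibMat⁻¹ = !![0, 1; 1, -1] := by
  have : (fibMat⁻¹).val = !![0, 1; 1, -1] := rfl
  rw [realMat, this]
  ext i j
  fin_cases i <;> fin_cases j <;> simp

/-- The vector `(t, 1)`. It is an eigenvector of `fibMat` when `t ^ 2 = t + 1`. -/
def eigenVec (t : ℝ) : Plane := ![t, 1]

theorem fibMat_mulVec_eigenVec {t : ℝ} (ht : t ^ 2 = t + 1) :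
    realMat fibMat *ᵥ eigenVec t = t • eigenVec t := by
  rw [realMat_fibMat]
  ext i
  fin_cases i <;> simp [eigenVec, Matrix.mulVec, dotProduct, Fin.sum_univ_two, ← ht, sq]

theorem fibMat_inv_mulVec_eigenVec {t : ℝ} (ht : t ^ 2 = t + 1) :
    realMat fibMat⁻¹ *ᵥ eigenVec t = t⁻¹ • eigenVec t := by
  have h0 : t ≠ 0 := by
    rintro rfl
    norm_num at ht
  rw [realMat_fibMat_inv]
  ext i
  fin_cases i
  · simp [eigenVec, Matrix.mulVec, dotProduct, Fin.sum_univ_two, h0]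
  · simp [eigenVec, Matrix.mulVec, dotProduct, Fin.sum_univ_two]
    field_simp
    linarith

theorem pow_mulVec_of_eigen {N : Matrix (Fin 2) (Fin 2) ℝ} {e : Plane} {a : ℝ}
    (h : N *ᵥ e = a • e) (n : ℕ) : (N ^ n) *ᵥ e = a ^ n • e := by
  induction n with
  | zero => simp
  | succ n ih => rw [pow_succ, ← Matrix.mulVec_mulVec, h, Matrix.mulVec_smul, ih, smul_smul,
      pow_succ']

theorem eq_eigenVec_combination (v : Plane) :
    v = ((Real.goldenRatio * v 1 - v 0) / √5) • eigenVec Real.goldenConj +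
      ((v 0 - Real.goldenConj * v 1) / √5) • eigenVec Real.goldenRatio := by
  have h5 : √5 ≠ 0 := by positivity
  -- Up to sign, `√5` is the determinant of the eigenbasis.
  have h1 := Real.goldenRatio_sub_goldenConj
  ext i
  fin_cases i
  · simp [eigenVec]
    rw [← h1] at h5 ⊢
    field_simp
    ring
  · simp [eigenVec]
    rw [← h1] at h5 ⊢
    field_simp
    ring

theorem mem_stableSpace_of_eigen {M : GL (Fin 2) ℤ} {e : Plane} {a : ℝ}
    (h : realMat M *ᵥ e = a • e) (ha : |a| < 1) (s : ℝ) : s • e ∈ stableSpace M := by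
  refine (stableSpace M).smul_mem s ?_
  change Tendsto (fun n : ℕ => (realMat M ^ n) *ᵥ e) atTop (𝓝 0)
  simp only [pow_mulVec_of_eigen h]
  simpa using (tendsto_pow_atTop_nhds_zero_of_abs_lt_one ha).smul_const e

/-- Along an expanding eigenline norms never drop below their initial value, so they tend to zero
only for the zero vector. -/
theorem eq_zero_of_smul_mem_stableSpace {M : GL (Fin 2) ℤ} {e : Plane} {a s : ℝ} (he : e ≠ 0)
    (h : realMat M *ᵥ e = a • e) (ha : 1 < |a|) (hs : s • e ∈ stableSpace M) : s = 0 := by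
  by_contra hs0
  change Tendsto (fun n : ℕ => (realMat M ^ n) *ᵥ (s • e)) atTop (𝓝 0) at hs
  have h1 : Tendsto (fun n : ℕ => ‖(realMat M ^ n) *ᵥ (s • e)‖) atTop (𝓝 0) := by
    simpa using hs.norm
  have hpos : 0 < ‖s • e‖ := norm_pos_iff.2 (smul_ne_zero hs0 he)
  obtain ⟨n, hn⟩ := (h1.eventually_lt_const hpos).exists
  rw [Matrix.mulVec_smul, pow_mulVec_of_eigen h, smul_comm, norm_smul, norm_pow] at hn
  have : 1 ≤ ‖a‖ ^ n := one_le_pow₀ ha.le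
  nlinarith

theorem eigenVec_ne_zero (t : ℝ) : eigenVec t ≠ 0 := fun h => by
  simpa [eigenVec] using congrFun h 1

theorem abs_goldenConj : |Real.goldenConj| = Real.goldenRatio⁻¹ := by
  rw [abs_of_neg Real.goldenConj_neg, Real.inv_goldenRatio]

theorem abs_goldenConj_lt_one : |Real.goldenConj| < 1 := by
  rw [abs_goldenConj]
  exact inv_lt_one_of_one_lt₀ Real.one_lt_goldenRatio

/-- Subtracting the contracted component of a stable vector leaves a stable vector on the expanding
eigenline, which must vanish. -/
theorem mem_stableSpace_fibMat_iff (v : Plane) :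
    v ∈ stableSpace fibMat ↔ ∃ s : ℝ, v = s • eigenVec Real.goldenConj := by
  constructor
  · intro hv
    have e := eq_eigenVec_combination v
    generalize (Real.goldenRatio * v 1 - v 0) / √5 = s at e
    generalize (v 0 - Real.goldenConj * v 1) / √5 = t at e
    have h1 : t • eigenVec Real.goldenRatio ∈ stableSpace fibMat := by
      have h2 := (stableSpace fibMat).sub_mem hv (mem_stableSpace_of_eigen
        (fibMat_mulVec_eigenVec Real.goldenConj_sq) abs_goldenConj_lt_one s)
      rwa [e, add_sub_cancel_left] at h2
    have ht := eq_zero_of_smul_mem_stableSpace (eigenVec_ne_zero _)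
      (fibMat_mulVec_eigenVec Real.goldenRatio_sq)
      (by rw [abs_of_pos Real.goldenRatio_pos]; exact Real.one_lt_goldenRatio) h1
    exact ⟨s, by rw [e, ht]; simp⟩
  · rintro ⟨s, rfl⟩
    exact mem_stableSpace_of_eigen (fibMat_mulVec_eigenVec Real.goldenConj_sq)
      abs_goldenConj_lt_one s

theorem mem_unstableSpace_fibMat_iff (v : Plane) :
    v ∈ unstableSpace fibMat ↔ ∃ s : ℝ, v = s • eigenVec Real.goldenRatio := by
  have hlt : |Real.goldenRatio⁻¹| < 1 := by
    rw [abs_of_pos (inv_pos.2 Real.goldenRatio_pos)]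
    exact inv_lt_one_of_one_lt₀ Real.one_lt_goldenRatio
  constructor
  · intro hv
    have e := eq_eigenVec_combination v
    generalize (Real.goldenRatio * v 1 - v 0) / √5 = s at e
    generalize (v 0 - Real.goldenConj * v 1) / √5 = t at e
    have h1 : s • eigenVec Real.goldenConj ∈ stableSpace fibMat⁻¹ := by
      have h2 := (stableSpace fibMat⁻¹).sub_mem hv (mem_stableSpace_of_eigen
        (fibMat_inv_mulVec_eigenVec Real.goldenRatio_sq) hlt t)
      rwa [e, add_sub_cancel_right] at h2
    have hs := eq_zero_of_smul_mem_stableSpace (eigenVec_ne_zero _)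
      (fibMat_inv_mulVec_eigenVec Real.goldenConj_sq)
      (by rw [abs_inv, abs_goldenConj, inv_inv]; exact Real.one_lt_goldenRatio) h1
    exact ⟨t, by rw [e, hs]; simp⟩
  · rintro ⟨s, rfl⟩
    exact mem_stableSpace_of_eigen (fibMat_inv_mulVec_eigenVec Real.goldenRatio_sq) hlt s

theorem isCompl_fibMat : IsCompl (stableSpace fibMat) (unstableSpace fibMat) := by
  constructor
  · rw [Submodule.disjoint_def]
    intro v hs hu
    obtain ⟨s, rfl⟩ := (mem_stableSpace_fibMat_iff v).1 hs
    obtain ⟨t, ht⟩ := (mem_unstableSpace_fibMat_iff _).1 hu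
    have h0 := congrFun ht 0
    have h1 := congrFun ht 1
    simp [eigenVec] at h0 h1
    have hne : Real.goldenRatio - Real.goldenConj ≠ 0 := by
      have := Real.goldenConj_neg
      have := Real.goldenRatio_pos
      linarith
    have hs0 : s * (Real.goldenRatio - Real.goldenConj) = 0 := by
      rw [h1] at h0 ⊢
      linarith
    rw [(mul_eq_zero.1 hs0).resolve_right hne, zero_smul]
  · rw [codisjoint_iff, Submodule.eq_top_iff']
    intro v
    rw [eq_eigenVec_combination v]
    exact Submodule.add_mem_sup ((mem_stableSpace_fibMat_iff _).2 ⟨_, rfl⟩)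
      ((mem_unstableSpace_fibMat_iff _).2 ⟨_, rfl⟩)

/-- The characteristic polynomial `z² - z - 1` has the real roots φ and `-φ⁻¹`. -/
theorem isAnosov_fibMat : IsAnosov fibMat := by
  intro z hz hz1
  have hp : z ^ 2 = z + 1 := by
    have e : (fibMat.val.map (Int.cast : ℤ → ℂ)) = !![1, 1; 1, 0] := by
      ext i j
      fin_cases i <;> fin_cases j <;> simp [fibMat]
    rw [e, Polynomial.IsRoot, Matrix.charpoly_fin_two] at hz
    simp [Matrix.trace_fin_two, Matrix.det_fin_two] at hz
    linear_combination hz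
  have hroot : (z - (Real.goldenRatio : ℂ)) * (z - (Real.goldenConj : ℂ)) = 0 := by
    have h1 : (Real.goldenRatio : ℂ) + (Real.goldenConj : ℂ) = 1 := by
      exact_mod_cast Real.goldenRatio_add_goldenConj
    have h2 : (Real.goldenRatio : ℂ) * (Real.goldenConj : ℂ) = -1 := by
      exact_mod_cast Real.goldenRatio_mul_goldenConj
    linear_combination hp - z * h1 + h2
  rcases mul_eq_zero.1 hroot with h | h
  · rw [sub_eq_zero.1 h, Complex.norm_real, Real.norm_of_nonneg Real.goldenRatio_pos.le] at hz1
    exact absurd hz1 Real.one_lt_goldenRatio.ne'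
  · rw [sub_eq_zero.1 h, Complex.norm_real, Real.norm_eq_abs] at hz1
    exact absurd hz1 abs_goldenConj_lt_one.ne

/-- The Euclidean metric. -/
def euclideanMetric : RiemMetric where
  gram _ := 1
  posDef _ := Matrix.PosDef.one
  smooth _ _ := contDiff_const

theorem euclideanMetric_length_smul (x y : Torus) (a : ℝ) (v : Plane) :
    euclideanMetric.length x (a • v) = |a| * euclideanMetric.length y v := by
  simp only [RiemMetric.length, euclideanMetric, Matrix.one_mulVec, smul_dotProduct,
    dotProduct_smul, smul_eq_mul, ← mul_assoc]
  rw [Real.sqrt_mul (mul_self_nonneg a), Real.sqrt_mul_self_eq_abs]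

/-- Constant rates for the Fibonacci automorphism. -/
def fibRates (ν : ℝ) (h : Real.goldenRatio⁻¹ < ν) (h1 : ν < 1) : HyperbolicRates fibMat where
  splitting := isCompl_fibMat
  metric := euclideanMetric
  nu _ := ν
  nuHat _ := ν
  continuous_nu := continuous_const
  continuous_nuHat := continuous_const
  nu_pos _ := (inv_pos.2 Real.goldenRatio_pos).trans h
  nuHat_pos _ := (inv_pos.2 Real.goldenRatio_pos).trans h
  nu_lt_one _ := h1
  nuHat_lt_one _ := h1
  stable x v hv hl := by
    obtain ⟨s, rfl⟩ := (mem_stableSpace_fibMat_iff v).1 hv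
    rw [Matrix.mulVec_smul, fibMat_mulVec_eigenVec Real.goldenConj_sq, smul_comm,
      euclideanMetric_length_smul _ x, hl, mul_one, abs_goldenConj]
    exact h
  unstable x v hv hl := by
    obtain ⟨s, rfl⟩ := (mem_unstableSpace_fibMat_iff v).1 hv
    rw [Matrix.mulVec_smul, fibMat_mulVec_eigenVec Real.goldenRatio_sq, smul_comm,
      euclideanMetric_length_smul _ x, hl, mul_one, abs_of_pos Real.goldenRatio_pos]
    exact inv_lt_of_inv_lt₀ Real.goldenRatio_pos h

theorem norm_fibMat_pow_mulVec {v : Plane} (hv : v ∈ stableSpace fibMat) (k : ℕ) :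
    ‖(realMat fibMat ^ k) *ᵥ v‖ = (Real.goldenRatio⁻¹) ^ k * ‖v‖ := by
  obtain ⟨s, rfl⟩ := (mem_stableSpace_fibMat_iff v).1 hv
  rw [Matrix.mulVec_smul, pow_mulVec_of_eigen (fibMat_mulVec_eigenVec Real.goldenConj_sq),
    smul_comm, norm_smul, norm_pow, Real.norm_eq_abs, abs_goldenConj]

/-- Both eigenvalues of the inverse have modulus at most φ. The constant is `2 * 3 * 2`: two
components, eigencoordinates at most `3 * ‖v‖`, eigenvectors of norm at most `2`. -/
theorem norm_fibMat_inv_pow_mulVec_le (v : Plane) (k : ℕ) :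
    ‖(realMat fibMat⁻¹ ^ k) *ᵥ v‖ ≤ 12 * Real.goldenRatio ^ k * ‖v‖ := by
  have hg1 := Real.one_lt_goldenRatio
  have hg2 := Real.goldenRatio_lt_two
  have hc1 := Real.neg_one_lt_goldenConj
  have hc0 := Real.goldenConj_neg
  have h5 : 1 ≤ √5 := Real.one_le_sqrt.2 (by norm_num)
  have hv0 : |v 0| ≤ ‖v‖ := norm_le_pi_norm v 0
  have hv1 : |v 1| ≤ ‖v‖ := norm_le_pi_norm v 1
  have he : ∀ t : ℝ, |t| ≤ 2 → ‖eigenVec t‖ ≤ 2 := by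
    intro t ht
    refine (pi_norm_le_iff_of_nonneg (by norm_num)).2 fun i => ?_
    fin_cases i
    · simpa [eigenVec] using ht
    · simp [eigenVec]
  have hcoef : ∀ a : ℝ, |a| ≤ 3 * ‖v‖ → |a / √5| ≤ 3 * ‖v‖ := by
    intro a ha
    rw [abs_div, abs_of_pos (by positivity : (0 : ℝ) < √5)]
    exact (div_le_self (abs_nonneg a) h5).trans ha
  have hs : |(Real.goldenRatio * v 1 - v 0) / √5| ≤ 3 * ‖v‖ := by
    refine hcoef _ ((abs_sub _ _).trans ?_)
    rw [abs_mul, abs_of_pos Real.goldenRatio_pos]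
    nlinarith [norm_nonneg v, abs_nonneg (v 1)]
  have ht : |(v 0 - Real.goldenConj * v 1) / √5| ≤ 3 * ‖v‖ := by
    refine hcoef _ ((abs_sub _ _).trans ?_)
    rw [abs_mul]
    have := abs_goldenConj_lt_one
    nlinarith [norm_nonneg v, abs_nonneg (v 1)]
  have e := eq_eigenVec_combination v
  generalize (Real.goldenRatio * v 1 - v 0) / √5 = s at e hs
  generalize (v 0 - Real.goldenConj * v 1) / √5 = t at e ht
  have hgc : |Real.goldenConj⁻¹| = Real.goldenRatio := by rw [abs_inv, abs_goldenConj, inv_inv]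
  have hgi : |Real.goldenRatio⁻¹ ^ k| ≤ Real.goldenRatio ^ k := by
    rw [abs_of_pos (pow_pos (inv_pos.2 Real.goldenRatio_pos) k)]
    exact pow_le_pow_left₀ (inv_pos.2 Real.goldenRatio_pos).le
      ((inv_le_one_of_one_le₀ hg1.le).trans hg1.le) k
  have hbound : ∀ (a c : ℝ) (u : Plane), |a| ≤ 3 * ‖v‖ → |c| ≤ Real.goldenRatio ^ k → ‖u‖ ≤ 2 →
      ‖a • c • u‖ ≤ 3 * ‖v‖ * (Real.goldenRatio ^ k * 2) := by
    intro a c u ha hc hu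
    rw [norm_smul, norm_smul]
    gcongr
    · exact ha
    · exact hc
  calc ‖(realMat fibMat⁻¹ ^ k) *ᵥ v‖
      = ‖s • Real.goldenConj⁻¹ ^ k • eigenVec Real.goldenConj +
          t • Real.goldenRatio⁻¹ ^ k • eigenVec Real.goldenRatio‖ := by
        conv_lhs => rw [e]
        rw [Matrix.mulVec_add, Matrix.mulVec_smul, Matrix.mulVec_smul,
          pow_mulVec_of_eigen (fibMat_inv_mulVec_eigenVec Real.goldenConj_sq),
          pow_mulVec_of_eigen (fibMat_inv_mulVec_eigenVec Real.goldenRatio_sq)]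
    _ ≤ 3 * ‖v‖ * (Real.goldenRatio ^ k * 2) + 3 * ‖v‖ * (Real.goldenRatio ^ k * 2) := by
        refine (norm_add_le _ _).trans (add_le_add (hbound _ _ _ hs ?_ ?_) (hbound _ _ _ ht hgi ?_))
        · rw [abs_pow, hgc]
        · exact he _ (by linarith [abs_goldenConj_lt_one])
        · exact he _ (by rw [abs_of_pos Real.goldenRatio_pos]; exact hg2.le)
    _ = 12 * Real.goldenRatio ^ k * ‖v‖ := by ring

/-! ### A nonnegative smooth function on the torus vanishing at the origin -/

/-- The function `1 - cos (2 π x₀)` on the torus. -/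
def wave (x : Torus) : ℝ := 1 - ((AddCircle.toCircle (x 0) : Circle) : ℂ).re

theorem wave_proj (v : Plane) : wave (proj v) = 1 - Real.cos (2 * Real.pi * v 0) := by
  rw [wave]
  congr 1
  change ((AddCircle.toCircle ((v 0 : ℝ) : UnitAddCircle) : Circle) : ℂ).re = _
  rw [AddCircle.toCircle_apply_mk, Circle.coe_exp, div_one, Complex.exp_ofReal_mul_I_re]

theorem wave_zero : wave 0 = 0 := by
  rw [← proj_zero, wave_proj]
  simp

theorem exists_eq_proj (x : Torus) : ∃ v : Plane, x = proj v := by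
  obtain ⟨v, hv, -⟩ := exists_eq_add_proj 0 x
  exact ⟨v, by rw [hv, zero_add]⟩

theorem wave_nonneg (x : Torus) : 0 ≤ wave x := by
  obtain ⟨v, rfl⟩ := exists_eq_proj x
  rw [wave_proj]
  linarith [Real.cos_le_one (2 * Real.pi * v 0)]

theorem wave_le_two (x : Torus) : wave x ≤ 2 := by
  obtain ⟨v, rfl⟩ := exists_eq_proj x
  rw [wave_proj]
  linarith [Real.neg_one_le_cos (2 * Real.pi * v 0)]

theorem continuous_wave : Continuous wave :=
  continuous_const.sub (Complex.continuous_re.comp (continuous_subtype_val.comp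
    (AddCircle.continuous_toCircle.comp (continuous_apply 0))))

theorem contDiff_wave_proj : ContDiff ℝ ∞ fun v : Plane => wave (proj v) := by
  simp only [wave_proj]
  fun_prop

theorem abs_wave_sub_le (x : Torus) (u : Plane) :
    |wave x - wave (x + proj u)| ≤ 2 * Real.pi * ‖u‖ := by
  obtain ⟨v, rfl⟩ := exists_eq_proj x
  rw [← proj_add, wave_proj, wave_proj]
  have h := Real.abs_cos_sub_cos_le (2 * Real.pi * (v + u) 0) (2 * Real.pi * v 0)
  have e : (1 - Real.cos (2 * Real.pi * v 0)) - (1 - Real.cos (2 * Real.pi * (v + u) 0)) =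
    Real.cos (2 * Real.pi * (v + u) 0) - Real.cos (2 * Real.pi * v 0) := by ring
  rw [e]
  refine h.trans ?_
  have e2 : 2 * Real.pi * (v + u) 0 - 2 * Real.pi * v 0 = 2 * Real.pi * u 0 := by
    simp
    ring
  rw [e2, abs_mul, abs_of_pos Real.two_pi_pos]
  exact mul_le_mul_of_nonneg_left (norm_le_pi_norm u 0) Real.two_pi_pos.le

/-- Interpolation: the Lipschitz bound serves at small scales, and the oscillation bound `2` at
large ones. -/
theorem abs_wave_sub_le_rpow {β : ℝ} (hβ0 : 0 < β) (hβ1 : β ≤ 1) (x : Torus) (u : Plane) :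
    |wave x - wave (x + proj u)| ≤ 2 * (2 * Real.pi * ‖u‖) ^ β := by
  have h0 : 0 ≤ 2 * Real.pi * ‖u‖ := by positivity
  rcases le_total (2 * Real.pi * ‖u‖) 1 with h | h
  · refine (abs_wave_sub_le x u).trans ?_
    have h1 := Real.rpow_le_rpow_of_exponent_ge' h0 h hβ0.le hβ1
    rw [Real.rpow_one] at h1
    linarith [Real.rpow_nonneg h0 β]
  · have h1 := Real.one_le_rpow h hβ0.le
    have h2 : |wave x - wave (x + proj u)| ≤ 2 :=
      abs_sub_le_iff.2 ⟨by linarith [wave_le_two x, wave_nonneg (x + proj u)],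
        by linarith [wave_nonneg x, wave_le_two (x + proj u)]⟩
    linarith

theorem abs_mul_wave_le {ε : ℝ} (hε : 0 < ε) (x : Torus) : |ε * wave x| ≤ 2 * ε := by
  rw [abs_of_nonneg (mul_nonneg hε.le (wave_nonneg x))]
  nlinarith [wave_le_two x]

/-- Stable vectors shrink exactly by `φ⁻ᵏ` and `wave` is Lipschitz, whence the ratio `r / φ` against
the weight `r ^ k`. -/
theorem mul_wave_decay {ε : ℝ} (hε : 0 < ε) {r : ℝˣ} (hr : 1 < (r : ℝ)) (x : Torus) (v : Plane)
    (hv : v ∈ stableSpace fibMat) (k : ℕ) :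
    |(r : ℝ) ^ k * (ε * wave ((torusAut fibMat ^ k) x) -
      ε * wave ((torusAut fibMat ^ k) (x + proj v)))| ≤
      ε * (2 * Real.pi) * ‖v‖ * (r * Real.goldenRatio⁻¹) ^ k := by
  rw [torusAut_pow_add_proj, ← mul_sub, abs_mul, abs_mul, abs_of_pos hε,
    abs_of_nonneg (by positivity : 0 ≤ (r : ℝ) ^ k)]
  have h := abs_wave_sub_le ((torusAut fibMat ^ k) x) ((realMat fibMat ^ k) *ᵥ v)
  rw [norm_fibMat_pow_mulVec hv] at h
  calc (r : ℝ) ^ k * (ε * |_|) ≤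
      (r : ℝ) ^ k * (ε * (2 * Real.pi * (Real.goldenRatio⁻¹ ^ k * ‖v‖))) := by gcongr
    _ = _ := by rw [mul_pow]; ring

/-- The transfer function is Hölder with any exponent `β` for which the contraction `r⁻¹` beats
the expansion `φ ^ β` of the backward dynamics. -/
theorem exists_holder_transfer {ε β : ℝ} (hε : 0 < ε) (hβ0 : 0 < β) (hβ1 : β ≤ 1) {r : ℝˣ}
    (hr : 1 < (r : ℝ)) (hrβ : Real.goldenRatio ^ β < r) :
    ∃ L : ℝ, ∀ x y : Torus,
      |transfer (torusAut fibMat) (fun x => ε * wave x) r x -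
        transfer (torusAut fibMat) (fun x => ε * wave x) r y| ≤ L * dist x y ^ β := by
  have hg := Real.goldenRatio_pos
  have hr0 : 0 < (r : ℝ) := zero_lt_one.trans hr
  set ρ : ℝ := (r : ℝ)⁻¹ * Real.goldenRatio ^ β with hρ
  have hρ0 : 0 ≤ ρ := by positivity
  have hρ1 : ρ < 1 := by
    rw [hρ, inv_mul_lt_iff₀ hr0, mul_one]
    exact hrβ
  have hsum : Summable fun n : ℕ => ρ ^ (n + 1) :=
    (summable_nat_add_iff 1).2 (summable_geometric_of_lt_one hρ0 hρ1)
  -- `24 * π` is the Lipschitz constant `2 * π` of `wave` times the `12` of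
  -- `norm_fibMat_inv_pow_mulVec_le`; the factor `2` comes from the interpolation.
  refine ⟨2 * ε * (24 * Real.pi) ^ β * ∑' n : ℕ, ρ ^ (n + 1), fun x y => ?_⟩
  obtain ⟨v, rfl, hv⟩ := exists_eq_add_proj x y
  rw [← hv]
  have hK := abs_mul_wave_le hε
  rw [transfer, transfer, ← (summable_transfer hr hK x).tsum_sub (summable_transfer hr hK _),
    ← tsum_mul_left, ← tsum_mul_right, ← Real.norm_eq_abs]
  refine tsum_of_norm_bounded (((hsum.mul_left _).mul_right _).hasSum) fun n => ?_
  rw [← mul_sub, ← mul_sub, torusAut_inv, torusAut_pow_add_proj, Real.norm_eq_abs, abs_mul, abs_mul,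
    abs_of_pos hε, abs_of_nonneg (by positivity : 0 ≤ ((r : ℝ)⁻¹) ^ (n + 1))]
  have h1 := abs_wave_sub_le_rpow hβ0 hβ1 ((torusAut fibMat⁻¹ ^ (n + 1)) x)
    ((realMat fibMat⁻¹ ^ (n + 1)) *ᵥ v)
  have h2 : (2 * Real.pi * ‖(realMat fibMat⁻¹ ^ (n + 1)) *ᵥ v‖) ^ β ≤
      (24 * Real.pi) ^ β * (Real.goldenRatio ^ β) ^ (n + 1) * ‖v‖ ^ β := by
    have h3 : 2 * Real.pi * ‖(realMat fibMat⁻¹ ^ (n + 1)) *ᵥ v‖ ≤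
        24 * Real.pi * Real.goldenRatio ^ (n + 1) * ‖v‖ := by
      have := mul_le_mul_of_nonneg_left (norm_fibMat_inv_pow_mulVec_le v (n + 1))
        Real.two_pi_pos.le
      linarith
    refine (Real.rpow_le_rpow (by positivity) h3 hβ0.le).trans (le_of_eq ?_)
    rw [Real.mul_rpow (by positivity) (norm_nonneg v),
      Real.mul_rpow (by positivity) (by positivity), ← Real.rpow_natCast,
      ← Real.rpow_natCast, ← Real.rpow_mul hg.le, ← Real.rpow_mul hg.le,
      mul_comm β]
  calc ((r : ℝ)⁻¹) ^ (n + 1) * (ε * |_|) ≤ ((r : ℝ)⁻¹) ^ (n + 1) * (ε * (2 *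
        ((24 * Real.pi) ^ β * (Real.goldenRatio ^ β) ^ (n + 1) * ‖v‖ ^ β))) := by
        gcongr
        exact h1.trans (mul_le_mul_of_nonneg_left h2 zero_le_two)
    _ = _ := by
        rw [hρ, mul_pow]
        ring

theorem isHolder_shear {w : Torus → ℝ} {L β : ℝ} (h : ∀ x y, |w x - w y| ≤ L * dist x y ^ β)
    (q : ℝˣ) : IsHolder β fun x => shear (w x) q := by
  refine ⟨L * (1 + |((q⁻¹ : ℝˣ) : ℝ)|), fun x y => (glDist_shear_le _ _ _).trans ?_⟩
  rw [mul_right_comm]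
  exact mul_le_mul_of_nonneg_right (h x y) (by positivity)

/-- The norms are at most `r + δ` and `1 + δ / r = (r + δ) / r`, so their product is at most `(r +
δ) ^ 2 / r`. -/
theorem bunching_shear_lt_one {p δ ν : ℝ} {r : ℝˣ} (hr : 1 ≤ (r : ℝ)) (hp : |p| ≤ δ) (hν : 0 < ν)
    (h : (r + δ) ^ 2 * ν < r) :
    ‖(shear p r).op‖ * ‖((shear p r)⁻¹).op‖ * ν ^ (1 : ℝ) < 1 := by
  have hr0 : 0 < (r : ℝ) := zero_lt_one.trans_le hr
  have hδ : 0 ≤ δ := (abs_nonneg p).trans hp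
  have h1 : ‖(shear p r).op‖ ≤ r + δ :=
    (norm_shear_le p r r hr (by rw [abs_of_pos hr0])).trans (by linarith)
  have h2 : ‖((shear p r)⁻¹).op‖ ≤ (r + δ) / r := by
    rw [shear_inv]
    have hi : ((r⁻¹ : ℝˣ) : ℝ) = (r : ℝ)⁻¹ := Units.val_inv_eq_inv_val r
    refine (norm_shear_le _ _ 1 le_rfl ?_).trans ?_
    · rw [hi, abs_of_pos (inv_pos.2 hr0)]
      exact inv_le_one_of_one_le₀ hr
    · rw [abs_mul, abs_neg, hi, abs_of_pos (inv_pos.2 hr0), add_div, div_self hr0.ne', div_eq_mul_inv]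
      gcongr
  rw [Real.rpow_one]
  calc _ ≤ (r + δ) * ((r + δ) / r) * ν := by gcongr
    _ = (r + δ) ^ 2 * ν / r := by ring
    _ < 1 := (div_lt_one hr0).2 h

/-! ### A homoclinic point of the origin -/

/-- A point homoclinic to the origin for the Fibonacci automorphism. -/
def homoclinicPoint : Torus := proj ((√5)⁻¹ • eigenVec Real.goldenRatio)

/-- The two eigenvectors differ by `√5` times the first basis vector; dividing by `√5` makes the
difference integral. The point thus lies on both leaves of the origin. -/
theorem homoclinicPoint_eq : homoclinicPoint = proj ((√5)⁻¹ • eigenVec Real.goldenConj) := by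
  have h5 : √5 ≠ 0 := by positivity
  have e : (√5)⁻¹ • eigenVec Real.goldenRatio =
      (√5)⁻¹ • eigenVec Real.goldenConj + ![1, 0] := by
    have h1 := Real.goldenRatio_sub_goldenConj
    ext i
    fin_cases i
    · simp [eigenVec]
      field_simp
      linarith
    · simp [eigenVec]
  have h0 : proj ![1, 0] = 0 := by
    funext i
    fin_cases i
    · exact AddCircle.coe_period 1
    · rfl
  rw [homoclinicPoint, e, proj_add, h0, add_zero]

theorem homoclinicPoint_mem_stable : homoclinicPoint ∈ leaf (stableSpace fibMat) 0 :=
  ⟨_, (mem_stableSpace_fibMat_iff _).2 ⟨(√5)⁻¹, rfl⟩, by rw [zero_add, homoclinicPoint_eq]⟩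

theorem homoclinicPoint_mem_unstable : homoclinicPoint ∈ leaf (unstableSpace fibMat) 0 :=
  ⟨_, (mem_unstableSpace_fibMat_iff _).2 ⟨(√5)⁻¹, rfl⟩, by rw [zero_add, homoclinicPoint]⟩

/-- The first coordinate `φ / √5` lies strictly between `0` and `1`, as `φ < 2 < √5`, while `wave`
vanishes only where that coordinate is an integer. -/
theorem wave_homoclinicPoint_pos : 0 < wave homoclinicPoint := by
  refine lt_of_le_of_ne (wave_nonneg _) fun h => ?_
  rw [homoclinicPoint, wave_proj, eq_comm, sub_eq_zero, eq_comm, Real.cos_eq_one_iff] at h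
  obtain ⟨n, hn⟩ := h
  have h5 : 2 < √5 := Real.lt_sqrt_of_sq_lt (by norm_num)
  have h5' : (0 : ℝ) < √5 := by linarith
  have hn' : (n : ℝ) = Real.goldenRatio / √5 := by
    have : (n : ℝ) * (2 * Real.pi) = Real.goldenRatio / √5 * (2 * Real.pi) := by
      rw [hn]
      simp [eigenVec]
      ring
    exact mul_right_cancel₀ Real.two_pi_pos.ne' this
  have h1 : (0 : ℝ) < n := by
    rw [hn']
    exact div_pos Real.goldenRatio_pos h5'
  have h2 : (n : ℝ) < 1 := by
    rw [hn', div_lt_one h5']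
    linarith [Real.goldenRatio_lt_two]
  have h3 : 0 < n := by exact_mod_cast h1
  have h4 : n < 1 := by exact_mod_cast h2
  omega

/-- The origin is fixed and `wave` vanishes there, so every term is nonpositive; the term `k = 0` is
strictly negative. -/
theorem stableDefect_zero_homoclinicPoint_neg {ε : ℝ} (hε : 0 < ε) {r : ℝˣ} (hr : 1 < (r : ℝ))
    (hrg : (r : ℝ) < Real.goldenRatio) :
    stableDefect (torusAut fibMat) (fun x => ε * wave x) r 0 homoclinicPoint < 0 := by
  have hs := summable_stableDefect (M := fibMat) (w := fun x => ε * wave x) (r := r)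
    (θ := r * Real.goldenRatio⁻¹) (mul_nonneg (zero_lt_one.trans hr).le
      (inv_pos.2 Real.goldenRatio_pos).le) (by
        rw [← div_eq_mul_inv]
        exact (div_lt_one Real.goldenRatio_pos).2 hrg)
    (mul_wave_decay hε hr) 0 homoclinicPoint homoclinicPoint_mem_stable
  have h0 : ∀ k : ℕ, (r : ℝ) ^ k * (ε * wave ((torusAut fibMat ^ k) 0) -
      ε * wave ((torusAut fibMat ^ k) homoclinicPoint)) ≤ 0 := by
    intro k
    rw [torusAut_pow_zero, wave_zero, mul_zero, zero_sub, mul_neg, neg_nonpos]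
    have := wave_nonneg ((torusAut fibMat ^ k) homoclinicPoint)
    positivity
  have h1 := hs.neg.le_tsum 0 fun k _ => neg_nonneg.2 (h0 k)
  rw [tsum_neg] at h1
  rw [stableDefect]
  have h2 := mul_pos hε wave_homoclinicPoint_pos
  simp [wave_zero] at h1
  linarith

theorem transfer_mul_wave_nonneg {ε : ℝ} (hε : 0 < ε) {r : ℝˣ} (hr : 1 < (r : ℝ)) (x : Torus) :
    0 ≤ transfer (torusAut fibMat) (fun x => ε * wave x) r x :=
  tsum_nonneg fun n => mul_nonneg (by positivity) (mul_nonneg hε.le (wave_nonneg _))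

theorem transfer_mul_wave_zero (ε : ℝ) (r : ℝˣ) :
    transfer (torusAut fibMat) (fun x => ε * wave x) r 0 = 0 := by
  simp only [transfer, torusAut_inv, torusAut_pow_zero, wave_zero, mul_zero, tsum_zero]

end HolCocycle
end

/-! ### Choice of the parameters and conclusion -/

open HolCocycle in
theorem proposition4p5 (β' : ℝ) (hβ'_pos : 0 < β') (hβ'_lt : β' < 1) :
    ∃ (M : GL (Fin 2) ℤ) (_ : IsAnosov M) (R : HyperbolicRates M)
      (A : Torus → GLOp (EuclideanSpace ℝ (Fin 2))) (b : GLOp (EuclideanSpace ℝ (Fin 2)))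
      (HAs HAu HBs HBu : Torus → Torus → GLOp (EuclideanSpace ℝ (Fin 2))),
      IsSmooth A ∧
      IsFiberBunched R 1 A ∧
      IsFiberBunched R 1 (fun _ => b) ∧
      (∃ C : Torus → GLOp (EuclideanSpace ℝ (Fin 2)),
        IsConjugacy (torusAut M) A (fun _ => b) C ∧ IsHolder β' C) ∧
      IsStandardStableHolonomy M A HAs ∧
      IsStandardUnstableHolonomy M A HAu ∧
      IsStandardStableHolonomy M (fun _ => b) HBs ∧
      IsStandardUnstableHolonomy M (fun _ => b) HBu ∧
      ∀ C : Torus → GLOp (EuclideanSpace ℝ (Fin 2)),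
        IsConjugacy (torusAut M) A (fun _ => b) C →
          ¬ (Intertwines (stableSpace M) C HAs HBs ∧
             Intertwines (unstableSpace M) C HAu HBu) := by
  have hg1 := Real.one_lt_goldenRatio
  have hg0 := Real.goldenRatio_pos
  have hgβ : Real.goldenRatio ^ β' < Real.goldenRatio := by
    simpa using Real.rpow_lt_rpow_of_exponent_lt hg1 hβ'_lt
  -- The lower bound gives the Hölder conjugacy; the upper one gives the stable holonomy and room
  -- for bunching.
  obtain ⟨r₀, hrβ, hrg⟩ := exists_between hgβ
  have hr1 : 1 < r₀ := (Real.one_lt_rpow hg1 hβ'_pos).trans hrβ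
  have hr0 : 0 < r₀ := zero_lt_one.trans hr1
  obtain ⟨r, rfl⟩ : ∃ r : ℝˣ, (r : ℝ) = r₀ := ⟨Units.mk0 r₀ hr0.ne', rfl⟩
  -- `φ⁻¹ < ν` makes `ν` a rate, and `ν < r⁻¹` makes the constant cocycle bunched.
  obtain ⟨ν, hgν, hνr⟩ := exists_between (inv_strictAnti₀ hr0 hrg)
  have hν0 : 0 < ν := (inv_pos.2 hg0).trans hgν
  have hν1 : ν < 1 := hνr.trans (inv_lt_one_of_one_lt₀ hr1)
  have hrν : (r : ℝ) < √(r / ν) := by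
    refine Real.lt_sqrt_of_sq_lt ((lt_div_iff₀ hν0).2 ?_)
    have : ν * r < 1 := by simpa [hr0.ne'] using mul_lt_mul_of_pos_right hνr hr0
    nlinarith
  -- `R - r` is the size of perturbation that bunching tolerates. As `wave ≤ 2`, it is to equal `2 *
  -- ε`.
  obtain ⟨R, hrR, hR⟩ := exists_between hrν
  have hR2 : R ^ 2 * ν < r := by
    rw [← lt_div_iff₀ hν0]
    exact (Real.lt_sqrt (hr0.trans hrR).le).1 hR
  set ε : ℝ := (R - r) / 2 with hεdef
  have hε : 0 < ε := by linarith
  have hbunch : ((r : ℝ) + 2 * ε) ^ 2 * ν < r := by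
    have : (r : ℝ) + 2 * ε = R := by rw [hεdef]; ring
    rwa [this]
  have hw := abs_mul_wave_le hε
  have hwc : Continuous fun x => ε * wave x := continuous_const.mul continuous_wave
  have hθ1 : (r : ℝ) * Real.goldenRatio⁻¹ < 1 := by
    rw [← div_eq_mul_inv]
    exact (div_lt_one hg0).2 hrg
  refine ⟨fibMat, isAnosov_fibMat, fibRates ν hgν hν1, fun x => shear (ε * wave x) r, shear 0 r,
    fun x y => shear (stableDefect (torusAut fibMat) (fun x => ε * wave x) r x y) 1,
    fun x y => shear (transfer (torusAut fibMat) (fun x => ε * wave x) r y -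
      transfer (torusAut fibMat) (fun x => ε * wave x) r x) 1,
    fun _ _ => 1, fun _ _ => 1,
    contDiff_shear_op (contDiff_const.mul contDiff_wave_proj) r,
    ⟨isHolder_shear (L := ε * (2 * Real.pi)) (fun x y => ?_) r, fun x => ?_⟩,
    ⟨isHolder_shear (w := fun _ => 0) (L := 0) (fun x y => by simp) r, fun x => ?_⟩,
    ⟨_, isConjugacy_shear_transfer hr1 hw, ?_⟩,
    isStandardStableHolonomy_shear hwc (by positivity) (by positivity) hθ1
      (mul_wave_decay hε hr1),
    isStandardUnstableHolonomy_shear hwc hr1 hw,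
    isStandardStableHolonomy_const _ _, isStandardUnstableHolonomy_const _ _, ?_⟩
  · obtain ⟨v, rfl, hv⟩ := exists_eq_add_proj x y
    rw [← hv, Real.rpow_one, ← mul_sub, abs_mul, abs_of_pos hε, mul_assoc]
    exact mul_le_mul_of_nonneg_left (abs_wave_sub_le x v) hε.le
  · exact and_self_iff.2 (bunching_shear_lt_one hr1.le (hw x) hν0 hbunch)
  · exact and_self_iff.2 (bunching_shear_lt_one hr1.le (by simpa using hε.le) hν0 hbunch)
  · obtain ⟨L, hL⟩ := exists_holder_transfer hε hβ'_pos hβ'_lt.le hr1 hrβ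
    exact isHolder_shear hL 1
  · rintro C - ⟨hs, hu⟩
    -- Both holonomies of `A` from the origin to the homoclinic point equal `C y * 1 * (C 0)⁻¹`, so
    -- their corners agree.
    have h := (hs 0 homoclinicPoint homoclinicPoint_mem_stable).trans
      (hu 0 homoclinicPoint homoclinicPoint_mem_unstable).symm
    have h1 := shear_injective 1 h
    have h2 := stableDefect_zero_homoclinicPoint_neg hε hr1 hrg
    rw [h1, transfer_mul_wave_zero, sub_zero] at h2
    exact absurd h2 (transfer_mul_wave_nonneg hε hr1 _).not_gt
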